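/- Let $F$ be a finite simple graph with $m$ edges and no isolated vertices, and let $k\ge 3$ be an integer. Let $r_k(F)$ denote the $k$-color Ramsey number of $F$, that is, the least integer $n\ge 0$ such that every coloring of the edges of the complete graph $K_n$ with $k$ colors contains a monochromatic copy of $F$ (as a not necessarily induced subgraph). Then $r_k(F)$ exists and $$r_k(F)\;\le\; k^{\,3\cdot 2^{-1/3}\,k\,m^{2/3}+k(2m)^{1/3}}\cdot 8m .$$ -/

import Mathlib

/-- Every coloring of the edges of the complete graph on `n` vertices with `k` colors contains a
monochromatic (not necessarily induced) copy of `F`: for some color `c`, the graph formed by the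
edges of color `c` contains a copy of `F`. -/
def RamseyArrows {V : Type*} (k : ℕ) (F : SimpleGraph V) (n : ℕ) : Prop :=
  ∀ C : SimpleGraph.TopEdgeLabeling (Fin n) (Fin k),
    ∃ c : Fin k, F.IsContained (C.labelGraph c)

/-- The `k`-color Ramsey number `r_k(F)`: the least `n` such that every `k`-coloring of the edges
of the complete graph on `n` vertices contains a monochromatic copy of `F`. -/
noncomputable def multicolorRamsey {V : Type*} (k : ℕ) (F : SimpleGraph V) : ℕ :=
  sInf {n : ℕ | RamseyArrows k F n}

/-!
The proof finds in every `k`-coloring of a large complete graph a color and, in this color, a chain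
of nested vertex sets into which `F` can be embedded. Put `d = (2m)^(1/3)` and `D = ⌊d⌋`. At most
`2m / (D + 1)` vertices of `F` have degree above `D`; they are treated separately from the rest,
whose degrees are at most `D`.

The chain is built by repeatedly passing from a vertex set `A` to a subset (`exists_chain`), each
time in the color that is densest inside `A`. In each color the first steps split off a vertex
joined to everything that remains, at the cost of a factor `k`, one for each vertex of large degree.
The next `D` steps, for `t = D, …, 1`, use dependent random choice (`dependent_random_choice`): the
common neighborhood of `t + 1` random vertices of `A` is about `k ^ (t + 1)` times smaller than `A`,
and very few of its `t`-tuples have a small common neighborhood in `A`. Once one color has made all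
its steps, the vertices of large degree are placed on the vertices split off, and the others are
embedded greedily, layer by layer (`exists_greedy_embedding`).

Two facts about the layers give the constant. They come from a proper coloring `f` of the part of
small degree with minimal color sum (`exists_layering`). Then a vertex of color `i` has a neighbor
in each class below `i`, hence at most `D - i` in the classes above; so `t`-tuples with
`t = D - i` suffice for its class, and the exponents add up to about `D² / 2` per color rather than
`D²`. For the same reason, the constraints that the choice of one image has to respect belong to
tuples of lengths no worse than `1, 2, 3, …`, one of each, and since `∑ 1 / (t (t + 1)) < 1` they can
be respected at a loss of `t (t + 1)` for each entry of a `t`-tuple. As `(2 t (t + 1)) ^ t` is at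
most `∏ (3 / 2) 3 ^ (i + 1)` over `1 ≤ i ≤ t` (`pow_le_prod_stepCost`), this loss is made up for by
the sizes of the sets in the chain; here `k ≥ 3` is used.
-/

open Finset
open scoped Classical

/-! ### Dependent random choice -/

/-- The vertices of `A` that are joined in `G` to every entry of the tuple `g`, where a vertex
counts as joined to itself. With this convention the colors of a complete graph have average
density at least `1 / k` inside every vertex set, without a correction for the diagonal. -/
noncomputable def commonNbrs {α ι : Type*} (G : SimpleGraph α) (A : Finset α) (g : ι → α) :
    Finset α :=
  {x ∈ A | ∀ i, g i = x ∨ G.Adj (g i) x}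

/-- The `t`-tuples in `B` having fewer than `b` common neighbors in `A`. -/
noncomputable def badTuples {α : Type*} (G : SimpleGraph α) (t b : ℕ) (A B : Finset α) :
    Finset (Fin t → α) :=
  {g ∈ Fintype.piFinset (fun _ : Fin t => B) | #(commonNbrs G A g) < b}

lemma mem_commonNbrs {α ι : Type*} {G : SimpleGraph α} {A : Finset α} {g : ι → α} {x : α} :
    x ∈ commonNbrs G A g ↔ x ∈ A ∧ ∀ i, g i = x ∨ G.Adj (g i) x := by
  simp [commonNbrs]

lemma mem_badTuples {α : Type*} {G : SimpleGraph α} {t b : ℕ} {A B : Finset α} {g : Fin t → α} :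
    g ∈ badTuples G t b A B ↔ (∀ i, g i ∈ B) ∧ #(commonNbrs G A g) < b := by
  simp [badTuples]

lemma badTuples_mono {α : Type*} (G : SimpleGraph α) (t b : ℕ) (A : Finset α) {B B' : Finset α}
    (h : B' ⊆ B) : badTuples G t b A B' ⊆ badTuples G t b A B := by
  intro g hg
  rw [mem_badTuples] at hg ⊢
  exact ⟨fun i => h (hg.1 i), hg.2⟩

/-- Some color has average degree at least `#A / k` inside `A`. -/
lemma exists_dense_color {α : Type*} {k : ℕ} (G : Fin k → SimpleGraph α)
    (hG : ∀ u v, u ≠ v → ∃ c, (G c).Adj u v) (hk : 0 < k) (A : Finset α) :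
    ∃ c, (#A) ^ 2 ≤ k * ∑ u ∈ A, #{x ∈ A | u = x ∨ (G c).Adj u x} := by
  have : Nonempty (Fin k) := ⟨⟨0, hk⟩⟩
  by_contra! hcon
  have h1 : ∑ c : Fin k, k * ∑ u ∈ A, #{x ∈ A | u = x ∨ (G c).Adj u x} < k * (#A) ^ 2 := by
    calc _ < ∑ _c : Fin k, (#A) ^ 2 :=
          sum_lt_sum_of_nonempty univ_nonempty fun c _ => hcon c
      _ = _ := by simp
  rw [← mul_sum] at h1
  have h2 := Nat.lt_of_mul_lt_mul_left h1
  rw [sum_comm] at h2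
  have h3 : ∀ u ∈ A, #A ≤ ∑ c : Fin k, #{x ∈ A | u = x ∨ (G c).Adj u x} := by
    intro u _
    calc #A ≤ #(univ.biUnion fun c : Fin k => {x ∈ A | u = x ∨ (G c).Adj u x}) := by
          apply card_le_card
          intro x hx
          simp only [mem_biUnion, mem_univ, true_and, mem_filter]
          by_cases hux : u = x
          · exact ⟨⟨0, hk⟩, hx, Or.inl hux⟩
          · obtain ⟨c, hc⟩ := hG u x hux
            exact ⟨c, hx, Or.inr hc⟩
      _ ≤ _ := card_biUnion_le
  have h4 := sum_le_sum h3
  rw [sum_const, smul_eq_mul] at h4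
  nlinarith

lemma sum_card_commonNbrs {α : Type*} (G : SimpleGraph α) (A : Finset α) (s : ℕ) :
    ∑ T ∈ Fintype.piFinset (fun _ : Fin s => A), #(commonNbrs G A T) =
      ∑ u ∈ A, (#{x ∈ A | u = x ∨ G.Adj u x}) ^ s := by
  have h := sum_card_bipartiteAbove_eq_sum_card_bipartiteBelow
    (s := Fintype.piFinset (fun _ : Fin s => A)) (t := A)
    (fun (T : Fin s → α) x => ∀ i, T i = x ∨ G.Adj (T i) x)
  have h' : ∀ T : Fin s → α, commonNbrs G A T =
      bipartiteAbove (fun (T : Fin s → α) x => ∀ i, T i = x ∨ G.Adj (T i) x) A T := by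
    intro T
    ext x
    rw [mem_commonNbrs, mem_bipartiteAbove]
  simp only [h', h]
  refine sum_congr rfl fun u _ => ?_
  have : bipartiteBelow (fun (T : Fin s → α) x => ∀ i, T i = x ∨ G.Adj (T i) x)
      (Fintype.piFinset (fun _ : Fin s => A)) u =
      Fintype.piFinset (fun _ : Fin s => {x ∈ A | u = x ∨ G.Adj u x}) := by
    ext T
    simp only [mem_bipartiteBelow, Fintype.mem_piFinset, mem_filter, G.adj_comm u, eq_comm (a := u)]
    exact ⟨fun h i => ⟨h.1 i, h.2 i⟩, fun h => ⟨fun i => (h i).1, fun i => (h i).2⟩⟩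
  rw [this]
  simp

/-- Double counting: a bad tuple lies in the common neighborhood of few tuples `T`. -/
lemma sum_card_badTuples_le {α : Type*} (G : SimpleGraph α) (A : Finset α) (s t b : ℕ) :
    ∑ T ∈ Fintype.piFinset (fun _ : Fin s => A), #(badTuples G t b A (commonNbrs G A T)) ≤
      (#A) ^ t * b ^ s := by
  have h1 : ∀ T ∈ Fintype.piFinset (fun _ : Fin s => A),
      badTuples G t b A (commonNbrs G A T) =
        bipartiteAbove (fun (T : Fin s → α) (g : Fin t → α) =>
          ∀ i j, T i = g j ∨ G.Adj (T i) (g j)) (badTuples G t b A A) T := by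
    intro T _
    ext g
    simp only [mem_badTuples, mem_commonNbrs, mem_bipartiteAbove]
    constructor
    · rintro ⟨h, h'⟩
      exact ⟨⟨fun i => (h i).1, h'⟩, fun i j => (h j).2 i⟩
    · rintro ⟨⟨h, h'⟩, h''⟩
      exact ⟨fun j => ⟨h j, fun i => h'' i j⟩, h'⟩
  rw [sum_congr rfl fun T hT => congrArg card (h1 T hT),
    sum_card_bipartiteAbove_eq_sum_card_bipartiteBelow]
  calc _ ≤ ∑ _g ∈ badTuples G t b A A, b ^ s := by
        refine sum_le_sum fun g hg => ?_
        have : bipartiteBelow (fun (T : Fin s → α) (g : Fin t → α) =>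
            ∀ i j, T i = g j ∨ G.Adj (T i) (g j)) (Fintype.piFinset (fun _ : Fin s => A)) g =
            Fintype.piFinset (fun _ : Fin s => commonNbrs G A g) := by
          ext T
          simp only [mem_bipartiteBelow, Fintype.mem_piFinset, mem_commonNbrs]
          constructor
          · rintro ⟨h, h'⟩ i
            exact ⟨h i, fun j => (h' i j).imp Eq.symm G.adj_symm⟩
          · intro h
            exact ⟨fun i => (h i).1, fun i j => ((h i).2 j).imp Eq.symm G.adj_symm⟩
        rw [this]
        simp only [Fintype.card_piFinset_const]
        exact Nat.pow_le_pow_left (mem_badTuples.mp hg).2.le s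
    _ = #(badTuples G t b A A) * b ^ s := by simp
    _ ≤ _ := by
        gcongr
        calc _ ≤ #(Fintype.piFinset (fun _ : Fin t => A)) := card_le_card (filter_subset _ _)
          _ = _ := by simp

/-- A vertex set can be shrunk to any smaller size without increasing the ratio of the number of
bad tuples to the number of vertices. -/
lemma exists_subset_badTuples_le {α : Type*} (G : SimpleGraph α) (t b : ℕ) (A X : Finset α)
    {y : ℕ} (hy : y ≤ #X) :
    ∃ Y ⊆ X, #Y = y ∧
      #(badTuples G (t + 1) b A Y) * #X ≤ #(badTuples G (t + 1) b A X) * y := by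
  induction hd : #X - y generalizing y with
  | zero =>
    obtain rfl : y = #X := by omega
    exact ⟨X, Subset.rfl, rfl, le_rfl⟩
  | succ e ih =>
    obtain ⟨Y, hYX, hYc, hY⟩ := ih (y := y + 1) (by omega) (by omega)
    have hne : Y.Nonempty := by rw [← card_pos]; omega
    -- delete the vertex that occurs most often as the first entry of a bad tuple
    obtain ⟨x, hx, hxc⟩ : ∃ x ∈ Y, #(badTuples G (t + 1) b A Y) ≤
        #Y * #{g ∈ badTuples G (t + 1) b A Y | g 0 = x} := by
      by_contra! hcon
      have h1 := sum_lt_sum_of_nonempty hne hcon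
      have h2 := card_eq_sum_card_fiberwise (s := badTuples G (t + 1) b A Y) (t := Y)
        (f := fun g : Fin (t + 1) → α => g 0) (fun g hg => (mem_badTuples.mp hg).1 0)
      rw [← mul_sum, ← h2] at h1
      simp at h1
    refine ⟨Y.erase x, (erase_subset _ _).trans hYX, by rw [card_erase_of_mem hx]; omega, ?_⟩
    have h2 : #(badTuples G (t + 1) b A (Y.erase x)) +
        #{g ∈ badTuples G (t + 1) b A Y | g 0 = x} ≤ #(badTuples G (t + 1) b A Y) := by
      rw [← card_union_of_disjoint]
      · refine card_le_card (union_subset (badTuples_mono _ _ _ _ (erase_subset _ _))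
          (filter_subset _ _))
      · rw [disjoint_left]
        intro g hg hg'
        exact ne_of_mem_erase ((mem_badTuples.mp hg).1 0)
          (mem_filter.mp hg').2
    rw [hYc] at hxc
    set p := #(badTuples G (t + 1) b A (Y.erase x))
    set q := #{g ∈ badTuples G (t + 1) b A Y | g 0 = x}
    set r := #(badTuples G (t + 1) b A Y)
    have h3 : p * (y + 1) ≤ r * y := by nlinarith
    refine Nat.le_of_mul_le_mul_left (c := y + 1) ?_ (Nat.succ_pos y)
    nlinarith [Nat.mul_le_mul_right (#X) h3, Nat.mul_le_mul_right y hY]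

/-- Dependent random choice: in a graph of density at least `1 / k` on `A`, some subset of size
about `#A / k ^ (t + 2)` has few `(t + 1)`-tuples with fewer than `b` common neighbors in `A`. -/
lemma dependent_random_choice {α : Type*} (G : SimpleGraph α) (A : Finset α) {k : ℕ} (hk : 0 < k)
    (t : ℕ) {b : ℕ} (hb : 0 < b)
    (hd : (#A) ^ 2 ≤ k * ∑ u ∈ A, #{x ∈ A | u = x ∨ G.Adj u x})
    (hA : 3 * k ^ (t + 2) ≤ #A) :
    ∃ Y ⊆ A, (2 : ℝ) / 3 * #A / k ^ (t + 2) ≤ #Y ∧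
      #(badTuples G (t + 1) b A Y) * #A ≤ 3 * b ^ (t + 2) := by
  obtain ⟨N, hN⟩ : ∃ N : ℝ, N = #A := ⟨_, rfl⟩
  rw [← hN]
  have hk' : (0 : ℝ) < k := by exact_mod_cast hk
  have hA' : 3 * (k : ℝ) ^ (t + 2) ≤ N := by rw [hN]; exact_mod_cast hA
  have hN0 : 0 < N := lt_of_lt_of_le (by positivity) hA'
  have hb' : (0 : ℝ) < b := by exact_mod_cast hb
  set Ts := Fintype.piFinset (fun _ : Fin (t + 2) => A) with hTs
  have hTc : (#Ts : ℝ) = N ^ (t + 2) := by rw [hTs]; simp [hN]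
  set μ : ℝ := N / k ^ (t + 2) with hμ
  have hμ3 : 3 ≤ μ := by rw [hμ, le_div_iff₀ (by positivity)]; exact hA'
  set E : ℝ := b ^ (t + 2) / N with hE
  have hE0 : 0 < E := by positivity
  have hsumX : N ^ (t + 2) * μ ≤ ∑ T ∈ Ts, (#(commonNbrs G A T) : ℝ) := by
    have h1 := sum_card_commonNbrs G A (t + 2)
    have h2 : ∑ T ∈ Ts, (#(commonNbrs G A T) : ℝ) =
        ∑ u ∈ A, (#{x ∈ A | u = x ∨ G.Adj u x} : ℝ) ^ (t + 2) := by exact_mod_cast h1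
    rw [h2]
    have h3 := pow_sum_div_card_le_sum_pow (s := A)
      (f := fun u => (#{x ∈ A | u = x ∨ G.Adj u x} : ℝ)) (fun _ _ => by positivity) (t + 1)
    refine le_trans ?_ h3
    have h4 : N ^ 2 / k ≤ ∑ u ∈ A, (#{x ∈ A | u = x ∨ G.Adj u x} : ℝ) := by
      rw [div_le_iff₀ hk', mul_comm, hN]
      exact_mod_cast hd
    calc N ^ (t + 2) * μ = (N ^ 2 / k) ^ (t + 2) / N ^ (t + 1) := by
          rw [hμ, div_pow]
          field_simp
          ring
      _ ≤ _ := by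
          rw [← hN]
          gcongr
  have hsumB : ∑ T ∈ Ts, (#(badTuples G (t + 1) b A (commonNbrs G A T)) : ℝ) ≤
      N ^ (t + 2) * E := by
    have h1 := sum_card_badTuples_le G A (t + 2) (t + 1) b
    have h2 : ∑ T ∈ Ts, (#(badTuples G (t + 1) b A (commonNbrs G A T)) : ℝ) ≤
        N ^ (t + 1) * b ^ (t + 2) := by rw [hN]; exact_mod_cast h1
    refine h2.trans (le_of_eq ?_)
    rw [hE]; field_simp; ring
  -- `μ` and `E` bound the averages of `#X` and of the number of bad tuples in `X`, so some `X` has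
  -- both `#X ≥ 2 / 3 * μ` and at most `3 * E * #X / μ` bad tuples
  obtain ⟨T, hT, hTle⟩ : ∃ T ∈ Ts, 2 * E * μ ≤
      3 * E * #(commonNbrs G A T) - μ * #(badTuples G (t + 1) b A (commonNbrs G A T)) := by
    have hne : Ts.Nonempty := by
      rw [← card_pos]
      have : (0 : ℝ) < #Ts := by rw [hTc]; positivity
      exact_mod_cast this
    apply exists_le_of_sum_le hne
    rw [sum_sub_distrib, ← mul_sum Ts _ (3 * E), ← mul_sum Ts _ μ, sum_const, nsmul_eq_mul, hTc]
    have h1 := mul_le_mul_of_nonneg_left hsumX (by positivity : 0 ≤ 3 * E)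
    have h2 := mul_le_mul_of_nonneg_left hsumB (by positivity : 0 ≤ μ)
    linarith
  obtain ⟨X, hXA, hTle⟩ : ∃ X ⊆ A, 2 * E * μ ≤ 3 * E * #X - μ * #(badTuples G (t + 1) b A X) :=
    ⟨_, fun x hx => (mem_commonNbrs.mp hx).1, hTle⟩
  obtain ⟨B, hBdef⟩ : ∃ B : ℝ, B = #(badTuples G (t + 1) b A X) := ⟨_, rfl⟩
  rw [← hBdef] at hTle
  have hB0 : 0 ≤ B := by rw [hBdef]; positivity
  have hX : 2 / 3 * μ ≤ #X := by
    have : 0 ≤ μ * B := by positivity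
    have : E * (2 * μ) ≤ E * (3 * #X) := by nlinarith
    have := le_of_mul_le_mul_left this hE0
    linarith
  have hB : μ * B ≤ 3 * E * #X := by
    have : 0 ≤ 2 * E * μ := by positivity
    linarith
  obtain ⟨Y, hYX, hYc, hY⟩ := exists_subset_badTuples_le G t b A X
    (y := ⌈2 / 3 * μ⌉₊) (Nat.ceil_le.mpr hX)
  have hyμ : (⌈2 / 3 * μ⌉₊ : ℝ) ≤ μ := by
    have := Nat.ceil_lt_add_one (by positivity : 0 ≤ 2 / 3 * μ)
    linarith
  refine ⟨Y, hYX.trans hXA, ?_, ?_⟩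
  · rw [hYc]
    refine le_trans (le_of_eq ?_) (Nat.le_ceil _)
    rw [hμ]; ring
  · have hY' : (#(badTuples G (t + 1) b A Y) : ℝ) * #X ≤ B * ⌈2 / 3 * μ⌉₊ := by
      rw [hBdef]
      exact_mod_cast hY
    have hX0 : (0 : ℝ) < #X := by linarith
    have h5 : (#(badTuples G (t + 1) b A Y) : ℝ) * #X ≤ 3 * E * #X := by
      calc _ ≤ B * ⌈2 / 3 * μ⌉₊ := hY'
        _ ≤ B * μ := by gcongr
        _ ≤ _ := by linarith
    have h6 := le_of_mul_le_mul_right h5 hX0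
    have h7 : (#(badTuples G (t + 1) b A Y) : ℝ) * N ≤ 3 * b ^ (t + 2) := by
      calc _ ≤ 3 * E * N := by gcongr
        _ = _ := by rw [hE]; field_simp
    rw [hN] at h7
    exact_mod_cast h7

/-! ### A layering of a graph of bounded degree -/

/-- A graph of maximum degree at most `D` has a proper coloring `τ` with values in `{0, …, D}` such
that each vertex `w` has at most `x` neighbors of color at most `x`, for every `x ≥ τ w`.

Take `τ = D - f`, where `f` is a proper coloring by natural numbers with minimal sum: then `w` has
a neighbor in each of the classes `f = 0, …, f w - 1`. -/
lemma exists_layering {V : Type*} [Fintype V] (H : SimpleGraph V) (D : ℕ)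
    (hD : ∀ v, #{u | H.Adj v u} ≤ D) :
    ∃ τ : V → ℕ, (∀ v, τ v ≤ D) ∧ (∀ u v, H.Adj u v → τ u ≠ τ v) ∧
      ∀ w x, τ w ≤ x → #{v | H.Adj w v ∧ τ v ≤ x} ≤ x := by
  obtain ⟨f, hf, hmin⟩ : ∃ f : V → ℕ, (∀ u v, H.Adj u v → f u ≠ f v) ∧
      ∀ g : V → ℕ, (∀ u v, H.Adj u v → g u ≠ g v) → ∑ v, f v ≤ ∑ v, g v := by
    have hex : ∃ s, ∃ f : V → ℕ, (∀ u v, H.Adj u v → f u ≠ f v) ∧ ∑ v, f v = s := by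
      refine ⟨_, fun v => Fintype.equivFin V v, fun u v huv h => huv.ne ?_, rfl⟩
      exact (Fintype.equivFin V).injective (Fin.ext h)
    obtain ⟨f, hf, hs⟩ := Nat.find_spec hex
    exact ⟨f, hf, fun g hg => hs ▸ Nat.find_min' hex ⟨g, hg, rfl⟩⟩
  have hnbr : ∀ v, ∀ i < f v, ∃ u, H.Adj v u ∧ f u = i := by
    intro v i hi
    by_contra! hcon
    have hlt : ∑ u, Function.update f v i u < ∑ u, f u := by
      apply sum_lt_sum
      · intro u _
        by_cases huv : u = v
        · subst huv; simp [hi.le]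
        · simp [huv]
      · exact ⟨v, mem_univ _, by simpa using hi⟩
    refine absurd (hmin _ fun u w huw => ?_) (not_le.mpr hlt)
    by_cases hu : u = v
    · subst hu
      simpa [huw.ne.symm] using (hcon w huw).symm
    · by_cases hw : w = v
      · subst hw
        simpa [hu] using hcon u huw.symm
      · simpa [hu, hw] using hf u w huw
  have hcount : ∀ w, ∀ y ≤ f w, y ≤ #{v | H.Adj w v ∧ f v < y} := by
    intro w y hy
    calc y = #(range y) := (card_range y).symm
      _ ≤ #(image f {v | H.Adj w v ∧ f v < y}) := by
          apply card_le_card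
          intro i hi
          rw [mem_range] at hi
          obtain ⟨u, hu, rfl⟩ := hnbr w i (by omega)
          exact mem_image_of_mem _ (by simp [hu, hi])
      _ ≤ _ := card_image_le
  have hfD : ∀ v, f v ≤ D := fun v =>
    (hcount v _ le_rfl).trans ((card_le_card fun u => by simp +contextual).trans (hD v))
  refine ⟨fun v => D - f v, fun v => Nat.sub_le _ _, fun u v huv h => hf u v huv ?_, ?_⟩
  · have := hfD u
    have := hfD v
    dsimp only at h
    omega
  · intro w x hx
    dsimp only at hx ⊢
    by_cases hxD : D ≤ x
    · exact ((card_le_card fun u => by simp +contextual).trans (hD w)).trans hxD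
    · have h1 := hcount w (D - x) (by omega)
      have h2 : #{v | H.Adj w v ∧ D - f v ≤ x} + #{v | H.Adj w v ∧ f v < D - x} ≤
          #{v | H.Adj w v} := by
        rw [← card_union_of_disjoint]
        · apply card_le_card
          intro u
          simp only [mem_union, mem_filter, mem_univ, true_and]
          tauto
        · rw [disjoint_left]
          intro u
          simp only [mem_filter, mem_univ, true_and, not_and, and_imp]
          intros
          omega
      have := hD w
      omega

/-- If at most `x` elements of `s` have `t`-value at most `x`, for all `x`, then the sum of
`1 / (t (t + 1))` is largest when the values are `1, 2, …, #s`. -/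
lemma sum_inv_mul_succ_le {V : Type*} (t : V → ℕ) (s : Finset V)
    (hs : ∀ x, #{v ∈ s | t v ≤ x} ≤ x) :
    ∑ v ∈ s, (1 : ℝ) / (t v * (t v + 1)) ≤ 1 - 1 / (#s + 1) := by
  induction hc : #s generalizing s with
  | zero => simp [card_eq_zero.mp hc]
  | succ q ih =>
    obtain ⟨w, hw, hmax⟩ := exists_max_image s t (card_pos.mp (by omega))
    have h1 : q + 1 ≤ t w := by
      have := hs (t w)
      rwa [filter_true_of_mem hmax, hc] at this
    have h2 := ih (s.erase w)
      (fun x => (card_le_card (filter_subset_filter _ (erase_subset _ _))).trans (hs x))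
      (by rw [card_erase_of_mem hw]; omega)
    rw [← add_sum_erase s _ hw]
    have h3 : (1 : ℝ) / (t w * (t w + 1)) ≤ 1 / ((q + 1) * (q + 2)) := by
      have : ((q + 1 : ℕ) : ℝ) ≤ t w := by exact_mod_cast h1
      push_cast at this
      exact one_div_le_one_div_of_le (by positivity)
        (mul_le_mul this (by linarith) (by positivity) (by positivity))
    have h4 : (1 : ℝ) / ((q + 1) * (q + 2)) = 1 / (q + 1) - 1 / (q + 2) := by
      field_simp
      ring
    push_cast
    have h5 : (q : ℝ) + 1 + 1 = q + 2 := by ring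
    rw [h5]
    linarith

/-! ### Greedy embedding -/

/-- If the vertices `φ u`, `u ∈ S`, have fewer than `b` common neighbors in `A`, then every
`t`-tuple in `B` in which they occur is bad. Here `e u` is the coordinate reserved for `φ u`, and
there are at least `t - #S` free coordinates. -/
lemma pow_le_card_agreeing {V α : Type*} (G : SimpleGraph α) {t b : ℕ} {A B : Finset α}
    (S : Finset V) (φ : V → α) (e : V → ℕ) (he : Set.InjOn e S) (het : ∀ u ∈ S, e u < t)
    (hφ : ∀ u ∈ S, φ u ∈ B) 
    (hb : ∀ C ⊆ A, (∀ x ∈ C, ∀ u ∈ S, φ u = x ∨ G.Adj (φ u) x) → #C < b)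
    (M : Finset (Fin t → α)) (hM : ∀ g ∈ badTuples G t b A B,
      (∀ u ∈ S, ∀ i : Fin t, e u = i → g i = φ u) → g ∈ M) :
    ∃ p, t - #S ≤ p ∧ (#B) ^ p ≤ #M := by
  set Q : Fin t → Finset α := fun i =>
    if h : ∃ u ∈ S, e u = i then {φ h.choose} else B with hQ
  have hQ1 : ∀ u ∈ S, ∀ i : Fin t, e u = i → Q i = {φ u} := by
    intro u hu i hi
    have h : ∃ u ∈ S, e u = i := ⟨u, hu, hi⟩
    simp only [hQ, dif_pos h]
    rw [he h.choose_spec.1 hu (h.choose_spec.2.trans hi.symm)]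
  refine ⟨#{i : Fin t | ¬ ∃ u ∈ S, e u = i}, ?_, ?_⟩
  · have h1 : #{i : Fin t | ∃ u ∈ S, e u = i} ≤ #S := by
      rw [← card_image_of_injOn he, ← card_map Fin.valEmbedding]
      apply card_le_card
      intro i
      simp only [mem_map, mem_filter, mem_univ, true_and, mem_image]
      rintro ⟨j, ⟨u, hu, hj⟩, rfl⟩
      exact ⟨u, hu, hj⟩
    have h2 := card_filter_add_card_filter_not (s := (univ : Finset (Fin t)))
      (fun i : Fin t => ∃ u ∈ S, e u = i)
    rw [card_univ, Fintype.card_fin] at h2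
    omega
  · have h1 : #(Fintype.piFinset Q) = (#B) ^ #{i : Fin t | ¬ ∃ u ∈ S, e u = i} := by
      rw [Fintype.card_piFinset, ← prod_const, prod_filter]
      refine prod_congr rfl fun i _ => ?_
      by_cases h : ∃ u ∈ S, e u = i
      · simp only [hQ, dif_pos h, card_singleton, if_neg (not_not.mpr h)]
      · simp only [hQ, dif_neg h, if_pos h]
    rw [← h1]
    apply card_le_card
    intro g hg
    rw [Fintype.mem_piFinset] at hg
    have hgφ : ∀ u ∈ S, ∀ i : Fin t, e u = i → g i = φ u := by
      intro u hu i hi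
      have := hg i
      rwa [hQ1 u hu i hi, mem_singleton] at this
    refine hM g (mem_badTuples.mpr ⟨fun i => ?_, hb _ (fun x hx => (mem_commonNbrs.mp hx).1)
      fun x hx u hu => ?_⟩) hgφ
    · by_cases h : ∃ u ∈ S, e u = i
      · obtain ⟨u, hu, hi⟩ := h
        rw [hgφ u hu i hi]
        exact hφ u hu
      · have := hg i
        simpa only [hQ, dif_neg h] using this
    · rw [mem_commonNbrs] at hx
      have := hx.2 ⟨e u, het u hu⟩
      rwa [hgφ u hu ⟨e u, het u hu⟩ rfl] at this

/-- Greedy embedding of `H` into `G`, the layer `τ = t` going into `P t`. The vertices are embedded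
in order of increasing `τ`, so that the neighbors of `v` placed before `v` lie in `P (τ v - 1)` and
need a large common neighborhood in `P (τ v)`. For each vertex `v` still to come, the number of bad
tuples that agree with the partial embedding on the neighbors of `v` is kept so small that none is
left once all of these are placed. Placing one neighbor costs a factor `τ v (τ v + 1) / n` against
this number; by `sum_inv_mul_succ_le` fewer than `n` candidates are thereby excluded. -/
lemma exists_greedy_embedding {V α : Type*} [Fintype V] (H : SimpleGraph V) (G : SimpleGraph α)
    {n D : ℕ} (hn : 0 < n) (τ : V → ℕ) (hτD : ∀ v, τ v ≤ D)
    (hproper : ∀ u v, H.Adj u v → τ u ≠ τ v)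
    (hτ : ∀ w x, τ w ≤ x → #{v | H.Adj w v ∧ τ v ≤ x} ≤ x)
    (P : ℕ → Finset α) (hP : ∀ r < D, P r ⊆ P (r + 1)) (hPc : ∀ r ≤ D, 2 * n ≤ #(P r))
    (hbad : ∀ r < D, #(badTuples G (r + 1) (2 * n) (P (r + 1)) (P r)) *
      ((r + 1) * (r + 2)) ^ (r + 1) < n ^ (r + 1))
    (hV : Fintype.card V ≤ n) :
    ∃ φ : V → α, Function.Injective φ ∧ (∀ v, φ v ∈ P (τ v)) ∧
      ∀ u v, H.Adj u v → G.Adj (φ u) (φ v) := by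
  have hn' : (0 : ℝ) < n := by exact_mod_cast hn
  have hPmono : ∀ a b, a ≤ b → b ≤ D → P a ⊆ P b := by
    intro a b hab
    induction b, hab using Nat.le_induction with
    | base => exact fun _ => Subset.rfl
    | succ b _ ih => exact fun hb => (ih (by omega)).trans (hP b (by omega))
  set S : V → Finset V := fun v => {u | H.Adj v u ∧ τ u < τ v} with hS
  have memS : ∀ v u, u ∈ S v ↔ H.Adj v u ∧ τ u < τ v := fun v u => by simp [hS]
  have hSc : ∀ v, #(S v) ≤ τ v := fun v => by
    refine le_trans (card_le_card fun u => ?_) (hτ v (τ v) le_rfl)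
    simp only [memS, mem_filter, mem_univ, true_and]
    exact fun h => ⟨h.1, h.2.le⟩
  obtain ⟨e, he, het⟩ : ∃ e : V → V → ℕ, (∀ v, Set.InjOn (e v) (S v)) ∧
      ∀ v, ∀ u ∈ S v, e v u < τ v := by
    have h1 : ∀ v, ∃ e : V → ℕ, Set.InjOn e (S v) ∧ ∀ u ∈ S v, e u < τ v := by
      intro v
      refine ⟨fun u => if h : u ∈ S v then (S v).equivFin ⟨u, h⟩ else 0, ?_, ?_⟩
      · intro u hu u' hu' h
        rw [mem_coe] at hu hu'
        simp only [hu, hu', dif_pos] at h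
        simpa using (S v).equivFin.injective (Fin.ext h)
      · intro u hu
        simp only [hu, dif_pos]
        exact lt_of_lt_of_le (Fin.is_lt _) (hSc v)
    choose e he using h1
    exact ⟨e, fun v => (he v).1, fun v => (he v).2⟩
  set β : ℕ → ℝ := fun t => t * (t + 1) / n with hβ
  set B : Finset V → (V → α) → (v : V) → Finset (Fin (τ v) → α) := fun U φ v =>
    {g ∈ badTuples G (τ v) (2 * n) (P (τ v)) (P (τ v - 1)) |
      ∀ u ∈ S v ∩ U, ∀ i : Fin (τ v), e v u = i → g i = φ u} with hB
  have memB : ∀ U φ v g, g ∈ B U φ v ↔ g ∈ badTuples G (τ v) (2 * n) (P (τ v)) (P (τ v - 1)) ∧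
      ∀ u ∈ S v ∩ U, ∀ i : Fin (τ v), e v u = i → g i = φ u := fun U φ v g => by simp [hB]
  have key : ∀ q ≤ Fintype.card V, ∃ (U : Finset V) (φ : V → α), #U = q ∧
      (∀ u ∈ U, ∀ w ∉ U, τ u ≤ τ w) ∧ Set.InjOn φ U ∧ (∀ u ∈ U, φ u ∈ P (τ u)) ∧
      (∀ u ∈ U, ∀ v ∈ U, H.Adj u v → G.Adj (φ u) (φ v)) ∧
      ∀ v ∉ U, 1 ≤ τ v → #(B U φ v) * β (τ v) ^ (τ v - #(S v ∩ U)) < 1 := by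
    intro q
    induction q with
    | zero =>
      intro _
      obtain ⟨a, -⟩ : (P 0).Nonempty := by
        rw [← card_pos]
        have := hPc 0 (Nat.zero_le _)
        omega
      refine ⟨∅, fun _ => a, rfl, by simp, by simp, by simp, by simp, ?_⟩
      intro v _ hv
      have h1 := hbad (τ v - 1) (by have := hτD v; omega)
      have h2 : τ v - 1 + 2 = τ v + 1 := by omega
      rw [Nat.sub_add_cancel hv, h2] at h1
      have h3 : (#(B ∅ (fun _ => a) v) : ℝ) ≤
          #(badTuples G (τ v) (2 * n) (P (τ v)) (P (τ v - 1))) := by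
        exact_mod_cast card_le_card (filter_subset _ _)
      have h4 : (#(badTuples G (τ v) (2 * n) (P (τ v)) (P (τ v - 1))) : ℝ) *
          (τ v * (τ v + 1)) ^ τ v < n ^ τ v := by exact_mod_cast h1
      simp only [inter_empty, card_empty, Nat.sub_zero, hβ]
      rw [div_pow, mul_div_assoc', div_lt_one (by positivity)]
      refine lt_of_le_of_lt ?_ h4
      gcongr
    | succ q ih =>
      intro hq
      obtain ⟨U, φ, hUc, hUτ, hinj, hφP, hadj, hpot⟩ := ih (by omega)
      obtain ⟨w, hwU, hwmin⟩ : ∃ w ∉ U, ∀ v ∉ U, τ w ≤ τ v := by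
        have hne : (Uᶜ).Nonempty := by
          rw [← card_pos, card_compl]
          omega
        obtain ⟨w, hw, h⟩ := exists_min_image Uᶜ τ hne
        exact ⟨w, by simpa using hw, fun v hv => h v (by simpa using hv)⟩
      have hSwU : S w ⊆ U := by
        intro u hu
        by_contra huU
        have := hwmin u huU
        have := ((memS w u).mp hu).2
        omega
      set X : Finset α := {x ∈ P (τ w) | ∀ u ∈ S w, φ u = x ∨ G.Adj (φ u) x} with hX
      have hXc : 2 * n ≤ #X := by
        rcases Nat.eq_zero_or_pos (τ w) with h0 | hpos
        · have : X = P (τ w) := by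
            rw [hX]
            apply filter_true_of_mem
            intro x _ u hu
            have := ((memS w u).mp hu).2
            omega
          rw [this]
          exact hPc _ (hτD w)
        · by_contra! hlt
          have hD' := hτD w
          obtain ⟨p, hp, hpc⟩ := pow_le_card_agreeing G (A := P (τ w)) (B := P (τ w - 1)) (S w) φ
            (e w) (he w) (het w) (fun u hu => hPmono (τ u) (τ w - 1)
              (by have := ((memS w u).mp hu).2; omega) (by omega) (hφP u (hSwU hu)))
            (fun C hCA hC => lt_of_le_of_lt (card_le_card fun x hx =>
              mem_filter.mpr ⟨hCA hx, hC x hx⟩) hlt) (B U φ w)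
            (fun g hg hgφ => (memB U φ w g).mpr ⟨hg, fun u hu => hgφ u (mem_inter.mp hu).1⟩)
          have h1 := hpot w hwU hpos
          have h2 : (#(P (τ w - 1)) : ℝ) ^ p ≤ #(B U φ w) := by exact_mod_cast hpc
          have h3 : (n : ℝ) ^ (τ w - #(S w)) ≤ (#(P (τ w - 1)) : ℝ) ^ p := by
            have h4 : n ≤ #(P (τ w - 1)) := by
              have := hPc (τ w - 1) (by omega)
              omega
            exact_mod_cast (Nat.pow_le_pow_left h4 _).trans
              (Nat.pow_le_pow_right (by omega) hp)
          rw [inter_eq_left.mpr hSwU] at h1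
          have h5 : 1 / (n : ℝ) ≤ β (τ w) := by
            have : (1 : ℝ) ≤ τ w := by exact_mod_cast hpos
            simp only [hβ]
            gcongr
            nlinarith
          have h6 : (n : ℝ) ^ (τ w - #(S w)) * (1 / (n : ℝ)) ^ (τ w - #(S w)) ≤
              #(B U φ w) * β (τ w) ^ (τ w - #(S w)) := by
            gcongr
            exact h3.trans h2
          rw [← mul_pow, mul_one_div_cancel hn'.ne', one_pow] at h6
          linarith
      set X' := X \ U.image φ with hX'
      have hX'c : n ≤ #X' := by
        have := card_image_le (s := U) (f := φ)
        have := le_card_sdiff (U.image φ) X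
        rw [← hX'] at this
        omega
      set K : Finset V := {v | H.Adj w v ∧ τ w < τ v} with hK
      have memK : ∀ v, v ∈ K ↔ H.Adj w v ∧ τ w < τ v := fun v => by simp [hK]
      have hKU : ∀ v ∈ K, v ∉ U := by
        intro v hv hvU
        have := hUτ v hvU w hwU
        have := ((memK v).mp hv).2
        omega
      have hwS : ∀ v ∈ K, w ∈ S v := fun v hv =>
        (memS v w).mpr ⟨((memK v).mp hv).1.symm, ((memK v).mp hv).2⟩
      have hSins : ∀ v ∈ K, S v ∩ insert w U = insert w (S v ∩ U) := fun v hv =>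
        inter_insert_of_mem (hwS v hv)
      have hSinsc : ∀ v ∈ K, #(S v ∩ insert w U) = #(S v ∩ U) + 1 := fun v hv => by
        rw [hSins v hv, card_insert_of_notMem (by simp [hwU])]
      -- the candidates whose choice would break the bound for `v`
      set E : V → Finset α := fun v => {x ∈ X' |
        1 ≤ #(B (insert w U) (Function.update φ w x) v) *
          β (τ v) ^ (τ v - #(S v ∩ insert w U))} with hE
      have hEc : ∀ v ∈ K, (#(E v) : ℝ) ≤ n * (1 / (τ v * (τ v + 1))) := by
        intro v hv
        have hpos : 1 ≤ τ v := by
          have := ((memK v).mp hv).2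
          omega
        have hdisj : ∑ x ∈ E v, #(B (insert w U) (Function.update φ w x) v) ≤ #(B U φ v) := by
          rw [← card_biUnion]
          · apply card_le_card
            intro g hg
            rw [mem_biUnion] at hg
            obtain ⟨x, _, hg⟩ := hg
            rw [memB] at hg ⊢
            refine ⟨hg.1, fun u hu i hi => ?_⟩
            rw [hg.2 u (by rw [hSins v hv]; exact mem_insert_of_mem hu) i hi]
            exact Function.update_of_ne (ne_of_mem_of_not_mem (mem_inter.mp hu).2 hwU) _ _
          · intro x _ x' _ hne
            refine disjoint_left.mpr fun g hg hg' => hne ?_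
            rw [memB] at hg hg'
            have hw' : w ∈ S v ∩ insert w U := by
              rw [hSins v hv]
              exact mem_insert_self _ _
            have h1 := hg.2 w hw' ⟨e v w, het v w (hwS v hv)⟩ rfl
            have h2 := hg'.2 w hw' ⟨e v w, het v w (hwS v hv)⟩ rfl
            rw [Function.update_self] at h1 h2
            exact h1.symm.trans h2
        have hsub : τ v - #(S v ∩ U) = (τ v - #(S v ∩ insert w U)) + 1 := by
          have h1 := hSinsc v hv
          have h2 : #(S v ∩ insert w U) ≤ τ v := (card_le_card inter_subset_left).trans (hSc v)
          omega
        have hβpos : 0 < β (τ v) := by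
          have : (0 : ℝ) < τ v := by exact_mod_cast hpos
          simp only [hβ]
          positivity
        have h1 : (#(E v) : ℝ) ≤ ∑ x ∈ E v, (#(B (insert w U) (Function.update φ w x) v) : ℝ) *
            β (τ v) ^ (τ v - #(S v ∩ insert w U)) := by
          rw [← nsmul_one, ← sum_const]
          exact sum_le_sum fun x hx => (mem_filter.mp hx).2
        rw [← sum_mul] at h1
        have h2 : (∑ x ∈ E v, (#(B (insert w U) (Function.update φ w x) v) : ℝ)) ≤
          #(B U φ v) := by exact_mod_cast hdisj
        have h3 := hpot v (hKU v hv) hpos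
        rw [hsub, pow_succ, ← mul_assoc] at h3
        have h4 : (#(E v) : ℝ) * β (τ v) ≤ 1 := by
          refine le_trans ?_ h3.le
          gcongr
          refine h1.trans ?_
          gcongr
        rw [← le_div_iff₀ hβpos] at h4
        refine h4.trans (le_of_eq ?_)
        simp only [hβ]
        field_simp
      obtain ⟨x, hxX', hxE⟩ : ∃ x ∈ X', ∀ v ∈ K, x ∉ E v := by
        by_contra! hcon
        have h1 : #X' ≤ ∑ v ∈ K, #(E v) := by
          refine le_trans (card_le_card fun x hx => ?_) card_biUnion_le
          obtain ⟨v, hv, hxv⟩ := hcon x hx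
          exact mem_biUnion.mpr ⟨v, hv, hxv⟩
        have h2 : (n : ℝ) ≤ ∑ v ∈ K, (#(E v) : ℝ) := by exact_mod_cast hX'c.trans h1
        have h3 := sum_inv_mul_succ_le τ K (fun y => by
          by_cases hy : τ w ≤ y
          · refine le_trans (card_le_card fun u => ?_) (hτ w y hy)
            simp only [mem_filter, memK, mem_univ, true_and]
            exact fun h => ⟨h.1.1, h.2⟩
          · rw [filter_false_of_mem]
            · simp
            · intro u hu
              have := ((memK u).mp hu).2
              omega)
        have h4 : (n : ℝ) ≤ n * (1 - 1 / (#K + 1)) :=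
          calc (n : ℝ) ≤ ∑ v ∈ K, (#(E v) : ℝ) := h2
            _ ≤ ∑ v ∈ K, n * ((1 : ℝ) / (τ v * (τ v + 1))) := sum_le_sum hEc
            _ = n * ∑ v ∈ K, (1 : ℝ) / (τ v * (τ v + 1)) := by rw [mul_sum]
            _ ≤ _ := by gcongr
        have h5 : (0 : ℝ) < 1 / (#K + 1) := by positivity
        nlinarith
      rw [hX', mem_sdiff, hX, mem_filter] at hxX'
      obtain ⟨⟨hxP, hxS⟩, hxU⟩ := hxX'
      have hupd : ∀ u ∈ U, Function.update φ w x u = φ u := fun u hu =>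
        Function.update_of_ne (ne_of_mem_of_not_mem hu hwU) _ _
      have hadjw : ∀ u ∈ U, H.Adj w u → G.Adj (φ u) x := by
        intro u hu hwu
        have h1 := hUτ u hu w hwU
        have h2 := hproper w u hwu
        have h3 : u ∈ S w := (memS w u).mpr ⟨hwu, by omega⟩
        exact (hxS u h3).resolve_left fun h => hxU (h ▸ mem_image_of_mem φ hu)
      refine ⟨insert w U, Function.update φ w x, by rw [card_insert_of_notMem hwU, hUc],
        ?_, ?_, ?_, ?_, ?_⟩
      · intro u hu v hv
        rw [mem_insert, not_or] at hv
        rcases mem_insert.mp hu with rfl | hu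
        · exact hwmin v hv.2
        · exact hUτ u hu v hv.2
      · rw [coe_insert, Set.injOn_insert (by simpa using hwU)]
        refine ⟨fun u hu u' hu' h => hinj hu hu' ?_, ?_⟩
        · rwa [hupd u hu, hupd u' hu'] at h
        · rintro ⟨u, hu, h⟩
          rw [Function.update_self, hupd u hu] at h
          exact hxU (h ▸ mem_image_of_mem φ hu)
      · intro u hu
        rcases mem_insert.mp hu with rfl | hu
        · rwa [Function.update_self]
        · rw [hupd u hu]
          exact hφP u hu
      · intro u hu v hv huv
        rcases mem_insert.mp hu with rfl | hu' <;> rcases mem_insert.mp hv with rfl | hv'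
        · exact absurd huv (H.irrefl)
        · rw [Function.update_self, hupd v hv']
          exact (hadjw v hv' huv).symm
        · rw [Function.update_self, hupd u hu']
          exact hadjw u hu' huv.symm
        · rw [hupd u hu', hupd v hv']
          exact hadj u hu' v hv' huv
      · intro v hv hpos
        rw [mem_insert, not_or] at hv
        by_cases hvK : v ∈ K
        · have h1 := hxE v hvK
          by_contra! hcon
          refine h1 (mem_filter.mpr ⟨?_, hcon⟩)
          rw [hX', mem_sdiff, hX, mem_filter]
          exact ⟨⟨hxP, hxS⟩, hxU⟩
        · have hwSv : w ∉ S v := fun h =>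
            hvK ((memK v).mpr ⟨((memS v w).mp h).1.symm, ((memS v w).mp h).2⟩)
          have h1 : S v ∩ insert w U = S v ∩ U := inter_insert_of_notMem hwSv
          have h2 : B (insert w U) (Function.update φ w x) v = B U φ v := by
            ext g
            rw [memB, memB, h1]
            refine and_congr_right fun _ => forall₂_congr fun u hu => ?_
            rw [hupd u (mem_inter.mp hu).2]
          rw [h1, h2]
          exact hpot v hv.2 hpos
  obtain ⟨U, φ, hUc, -, hinj, hφP, hadj, -⟩ := key _ le_rfl
  obtain rfl : U = univ := eq_univ_of_card U hUc
  exact ⟨φ, fun u v h => hinj (mem_coe.mpr (mem_univ u)) (mem_coe.mpr (mem_univ v)) h,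
    fun v => hφP v (mem_univ v),
    fun u v => hadj u (mem_univ u) v (mem_univ v)⟩

/-! ### Nested vertex sets -/

/-- Passing from the vertex set `A` to `A' ⊆ A` in one color when `r` more steps are to follow in
this color. For `r ≥ D` the step provides a vertex joined to all of `A'`, which serves as the image
of a vertex of large degree; for `r < D` it is a step of dependent random choice, after which few
`(r + 1)`-tuples in `A'` have fewer than `b` common neighbors in `A`. -/
def ColorStep {α : Type*} (G : SimpleGraph α) (D b r : ℕ) (A A' : Finset α) : Prop :=
  A' ⊆ A ∧ (r < D → #(badTuples G (r + 1) b A A') * #A ≤ 3 * b ^ (r + 2)) ∧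
    (D ≤ r → ∃ v ∈ A, v ∉ A' ∧ ∀ u ∈ A', G.Adj v u)

/-- The factor by which the vertex set shrinks, at most, in a `ColorStep`. -/
noncomputable def stepCost (k D r : ℕ) : ℝ :=
  if r < D then 3 / 2 * (k : ℝ) ^ (r + 2) else k

lemma ColorStep.mono {α : Type*} {G : SimpleGraph α} {D b r : ℕ} {A A' A'' : Finset α}
    (h : ColorStep G D b r A A') (hA : A'' ⊆ A') : ColorStep G D b r A A'' := by
  refine ⟨hA.trans h.1, fun hr => ?_, fun hr => ?_⟩
  · exact (Nat.mul_le_mul_right _ (card_le_card (badTuples_mono _ _ _ _ hA))).trans (h.2.1 hr)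
  · obtain ⟨v, hv, hv', hvu⟩ := h.2.2 hr
    exact ⟨v, hv, fun h' => hv' (hA h'), fun u hu => hvu u (hA hu)⟩

lemma one_le_stepCost {k : ℕ} (hk : 1 ≤ k) (D r : ℕ) : 1 ≤ stepCost k D r := by
  have hk' : (1 : ℝ) ≤ k := by exact_mod_cast hk
  unfold stepCost
  split_ifs
  · have := one_le_pow₀ hk' (n := r + 2)
    linarith
  · exact hk'

/-- The color of largest density in `A` admits every kind of step. Sizes are increased by `2` to
compensate for the loss of the vertex that is split off in the steps with `r ≥ D`. -/
lemma exists_colorStep {α : Type*} {k : ℕ} (hk : 2 ≤ k) (G : Fin k → SimpleGraph α)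
    (hG : ∀ u v, u ≠ v → ∃ c, (G c).Adj u v) (D : ℕ) {b : ℕ} (hb : 0 < b) (A : Finset α) :
    ∃ c, ∀ r, 8 * stepCost k D r ≤ #A + 2 →
      ∃ A', ColorStep (G c) D b r A A' ∧ ((#A : ℝ) + 2) / stepCost k D r ≤ #A' + 2 := by
  obtain ⟨c, hc⟩ := exists_dense_color G hG (by omega) A
  have hk' : (2 : ℝ) ≤ k := by exact_mod_cast hk
  refine ⟨c, fun r hr => ?_⟩
  by_cases hrD : r < D
  · simp only [stepCost, if_pos hrD] at hr ⊢
    have hk2 : (4 : ℝ) ≤ (k : ℝ) ^ (r + 2) := by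
      calc (4 : ℝ) = 2 ^ 2 := by norm_num
        _ ≤ (k : ℝ) ^ 2 := by gcongr
        _ ≤ _ := pow_le_pow_right₀ (by linarith) (by omega)
    have hA : (3 * k ^ (r + 2) : ℝ) ≤ #A := by linarith
    obtain ⟨Y, hYA, hYc, hY⟩ := dependent_random_choice (G c) A (by omega : 0 < k) r hb hc
      (by exact_mod_cast hA)
    refine ⟨Y, ⟨hYA, fun _ => hY, fun h => absurd h (by omega)⟩, ?_⟩
    rw [div_le_iff₀ (by positivity)]
    rw [div_le_iff₀ (by positivity)] at hYc
    nlinarith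
  · simp only [stepCost, if_neg hrD] at hr ⊢
    have hne : A.Nonempty := by
      rw [← card_pos]
      have : (0 : ℝ) < #A := by linarith
      exact_mod_cast this
    obtain ⟨v, hv, hvc⟩ : ∃ v ∈ A, #A ≤ k * #{x ∈ A | v = x ∨ (G c).Adj v x} := by
      by_contra! hcon
      have := sum_lt_sum_of_nonempty hne hcon
      rw [← mul_sum, sum_const, smul_eq_mul] at this
      nlinarith
    refine ⟨({x ∈ A | v = x ∨ (G c).Adj v x} : Finset α).erase v,
      ⟨(erase_subset _ _).trans (filter_subset _ _), fun h => absurd h hrD,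
        fun _ => ⟨v, hv, notMem_erase _ _, fun u hu => ?_⟩⟩, ?_⟩
    · rw [mem_erase, mem_filter] at hu
      exact hu.2.2.resolve_left hu.1.symm
    · rw [card_erase_of_mem (by simp [hv]), Nat.cast_sub
        (card_pos.mpr ⟨v, by simp [hv]⟩), div_le_iff₀ (by linarith)]
      have : (#A : ℝ) ≤ k * #{x ∈ A | v = x ∨ (G c).Adj v x} := by exact_mod_cast hvc
      push_cast
      nlinarith

/-- Repeated steps, where each vertex set determines in which color the next step can be made.
The color `c` still has to make `q c + 1` steps; some color makes all of its steps, and until then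
every other color makes at most `q c`. The sets of the final color are recorded as `P`, indexed by
the number of remaining steps. -/
lemma exists_chain {α : Type*} {k l : ℕ} (Step : Fin k → ℕ → Finset α → Finset α → Prop)
    (hsub : ∀ c r A A', Step c r A A' → A' ⊆ A)
    (hmono : ∀ c r A A' A'', Step c r A A' → A'' ⊆ A' → Step c r A A'')
    (cost : ℕ → ℝ) (hcost : ∀ r, 1 ≤ cost r) {M : ℝ} (hM : 0 ≤ M)
    (hstep : ∀ A, ∃ c, ∀ r ≤ l, M * cost r ≤ #A + 2 →
      ∃ A', Step c r A A' ∧ ((#A : ℝ) + 2) / cost r ≤ #A' + 2)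
    (q : Fin k → ℕ) (A : Finset α) (hq : ∀ c, q c ≤ l)
    (hA : M * cost 0 * ∏ c, ∏ i ∈ range (q c), cost (i + 1) ≤ #A + 2) :
    ∃ (c : Fin k) (P : ℕ → Finset α), P (q c + 1) ⊆ A ∧
      (∀ r ≤ q c, Step c r (P (r + 1)) (P r)) ∧
      ∀ r ≤ q c + 1, M * ∏ i ∈ range r, cost i ≤ #(P r) + 2 := by
  have hpos : ∀ r, 0 < cost r := fun r => lt_of_lt_of_le one_pos (hcost r)
  have hprod1 : ∀ {ι : Type} (s : Finset ι) (f : ι → ℝ), (∀ i, 1 ≤ f i) → 1 ≤ ∏ i ∈ s, f i :=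
    fun s f hf => prod_induction f (1 ≤ ·) (fun _ _ => one_le_mul_of_one_le_of_one_le) le_rfl
      fun i _ => hf i
  have hshift : ∀ m, ∏ i ∈ range (m + 1), cost i = cost 0 * ∏ i ∈ range m, cost (i + 1) :=
    fun m => by rw [prod_range_succ', mul_comm]
  induction hs : ∑ c, q c using Nat.strong_induction_on generalizing q A with
  | _ s ih =>
  have hsplit : ∀ c, M * cost 0 * ∏ c, ∏ i ∈ range (q c), cost (i + 1) =
      M * (∏ i ∈ range (q c + 1), cost i) *
        ∏ c' ∈ univ.erase c, ∏ i ∈ range (q c'), cost (i + 1) := by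
    intro c
    rw [← mul_prod_erase univ _ (mem_univ c), hshift]
    ring
  have hlarge : ∀ c, M * ∏ i ∈ range (q c + 1), cost i ≤ #A + 2 := by
    intro c
    refine le_trans ?_ hA
    rw [hsplit c]
    refine le_mul_of_one_le_right (mul_nonneg hM (prod_nonneg fun i _ => (hpos i).le)) ?_
    exact hprod1 _ _ fun c' => hprod1 _ _ fun i => hcost _
  obtain ⟨c₀, hc₀⟩ := hstep A
  obtain ⟨A', hAA', hA'⟩ := hc₀ (q c₀) (hq c₀) (by
    refine le_trans ?_ (hlarge c₀)
    gcongr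
    rw [prod_range_succ]
    exact le_mul_of_one_le_left (hpos _).le (hprod1 _ _ hcost))
  rcases Nat.eq_zero_or_eq_succ_pred (q c₀) with h0 | hsucc
  · refine ⟨c₀, fun r => if r = 0 then A' else A, by simp, ?_, ?_⟩
    · intro r hr
      obtain rfl : r = 0 := by omega
      rw [h0] at hAA'
      simpa using hAA'
    · intro r hr
      rcases Nat.eq_zero_or_pos r with rfl | hr'
      · simp only [range_zero, prod_empty, mul_one, if_pos]
        refine le_trans ?_ hA'
        rw [le_div_iff₀ (hpos _), h0]
        simpa [h0] using hlarge c₀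
      · obtain rfl : r = 1 := by omega
        simpa [h0] using hlarge c₀
  · obtain ⟨p, hp⟩ : ∃ p, q c₀ = p + 1 := ⟨_, hsucc⟩
    have hsum : ∑ c, Function.update q c₀ p c < s := by
      rw [← hs]
      apply sum_lt_sum
      · intro c _
        by_cases h : c = c₀
        · subst h; simp; omega
        · simp [h]
      · exact ⟨c₀, mem_univ _, by simp; omega⟩
    have herase : ∏ c' ∈ univ.erase c₀, ∏ i ∈ range (Function.update q c₀ p c'), cost (i + 1) =
        ∏ c' ∈ univ.erase c₀, ∏ i ∈ range (q c'), cost (i + 1) :=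
      prod_congr rfl fun c' hc' => by rw [Function.update_of_ne (ne_of_mem_erase hc')]
    obtain ⟨c, P, hPA, hPstep, hPc⟩ := ih _ hsum (Function.update q c₀ p) A' (by
        intro c
        by_cases h : c = c₀
        · subst h
          have := hq c
          simp
          omega
        · simpa [h] using hq c) (by
        refine le_trans ?_ hA'
        rw [le_div_iff₀ (hpos _)]
        refine le_trans (le_of_eq ?_) hA
        rw [hsplit c₀, ← mul_prod_erase univ _ (mem_univ c₀), herase, Function.update_self, hp,
          hshift, prod_range_succ]
        ring) rfl
    by_cases hc : c = c₀
    · subst hc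
      rw [Function.update_self] at hPA hPstep hPc
      refine ⟨c, Function.update P (p + 2) A, by simp [hp], ?_, ?_⟩
      · intro r hr
        rw [Function.update_of_ne (by omega : r ≠ p + 2)]
        by_cases hrp : r = p + 1
        · subst hrp
          rw [Function.update_self, ← hp]
          refine hmono c _ _ _ _ hAA' ?_
          rwa [hp]
        · rw [Function.update_of_ne (by omega)]
          exact hPstep r (by omega)
      · intro r hr
        by_cases hrp : r = p + 2
        · subst hrp
          rw [Function.update_self]
          have := hlarge c
          rwa [hp] at this
        · rw [Function.update_of_ne hrp]
          exact hPc r (by omega)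
    · rw [Function.update_of_ne hc] at hPA hPstep hPc
      exact ⟨c, P, hPA.trans (hsub _ _ _ _ hAA'), hPstep, hPc⟩

/-- The accumulated cost of the last `t` steps makes up for the loss in the greedy embedding of the
layer `t`. For `k = 2` the inequality fails at `t = 2`. -/
lemma pow_le_prod_stepCost {k D t : ℕ} (hk : 3 ≤ k) (ht : t ≤ D) :
    ((2 * (t * (t + 1)) : ℕ) : ℝ) ^ t ≤ ∏ i ∈ range t, stepCost k D i := by
  have hk' : (3 : ℝ) ≤ k := by exact_mod_cast hk
  have h1 : ∀ t : ℕ, 16 * (t * (t + 1)) ^ 2 ≤ 243 * 3 ^ t := by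
    intro t
    induction t with
    | zero => norm_num
    | succ t ih =>
      by_cases ht : t < 3
      · interval_cases t <;> norm_num
      · have : (t + 1 + 1) ^ 2 ≤ 3 * t ^ 2 := by nlinarith
        calc 16 * ((t + 1) * (t + 1 + 1)) ^ 2 = 16 * (t + 1) ^ 2 * (t + 1 + 1) ^ 2 := by ring
          _ ≤ 16 * (t + 1) ^ 2 * (3 * t ^ 2) := by gcongr
          _ = 3 * (16 * (t * (t + 1)) ^ 2) := by ring
          _ ≤ 3 * (243 * 3 ^ t) := by gcongr
          _ = _ := by ring
  have h2 : ∀ t : ℕ, (∏ i ∈ range t, (3 / 2 * (3 : ℝ) ^ (i + 2))) ^ 2 =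
      (9 / 4 * 3 ^ (t + 3)) ^ t := by
    intro t
    induction t with
    | zero => simp
    | succ t ih =>
      rw [prod_range_succ, mul_pow, ih]
      have : (9 / 4 * (3 : ℝ) ^ (t + 1 + 3)) ^ (t + 1) =
          (9 / 4 * 3 ^ (t + 3)) ^ t * 3 ^ t * (9 / 4 * 3 ^ (t + 4)) := by
        rw [← mul_pow, pow_succ]
        ring
      rw [this]
      ring
  -- compare squares, so that the exponent `t (t + 3) / 2` becomes an integer multiple of `t`
  have h3 : ((2 * (t * (t + 1)) : ℕ) : ℝ) ^ t ≤ ∏ i ∈ range t, (3 / 2 * (3 : ℝ) ^ (i + 2)) := by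
    refine le_of_sq_le_sq ?_ (prod_nonneg fun i _ => by positivity)
    rw [h2, ← pow_mul, mul_comm t 2, pow_mul]
    refine pow_le_pow_left₀ (by positivity) ?_ _
    have : (16 * (t * (t + 1)) ^ 2 : ℝ) ≤ 243 * 3 ^ t := by exact_mod_cast h1 t
    push_cast
    rw [pow_add]
    nlinarith
  refine h3.trans (prod_le_prod (fun i _ => by positivity) fun i hi => ?_)
  rw [mem_range] at hi
  rw [stepCost, if_pos (by omega)]
  gcongr

/-! ### Embedding a graph in one of the colors -/

/-- If the chain of steps in one color is available, the vertices of degree above `D` are sent to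
the vertices split off in the steps with `r ≥ D`, and the others are embedded greedily. -/
lemma isContained_of_chain {V α : Type*} [Fintype V] (F : SimpleGraph V) (G : SimpleGraph α)
    {k n D : ℕ} (hk : 3 ≤ k) (hn : 0 < n) (hV : Fintype.card V ≤ n) (P : ℕ → Finset α)
    (hstep : ∀ r < #{v | D < #{u | F.Adj v u}} + D, ColorStep G D (2 * n) r (P (r + 1)) (P r))
    (hcard : ∀ r ≤ D, 8 * (n : ℝ) * ∏ i ∈ range r, stepCost k D i ≤ #(P r) + 2) :
    F.IsContained G := by
  set Hi : Finset V := {v | D < #{u | F.Adj v u}} with hHi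
  have hn' : (1 : ℝ) ≤ n := by exact_mod_cast hn
  have hPmono : ∀ a b, a ≤ b → b ≤ #Hi + D → P a ⊆ P b := by
    intro a b hab
    induction b, hab using Nat.le_induction with
    | base => exact fun _ => Subset.rfl
    | succ b _ ih => exact fun hb => (ih (by omega)).trans (hstep b (by omega)).1
  -- the images of the vertices of large degree
  have hw : ∀ j : Fin #Hi, ∃ w ∈ P (D + j + 1), ∀ u ∈ P (D + j), G.Adj w u := by
    intro j
    obtain ⟨w, hw, -, hwu⟩ := (hstep (D + j) (by omega)).2.2 (by omega)
    exact ⟨w, hw, hwu⟩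
  choose w hwP hwadj using hw
  have hwlt : ∀ i j, i < j → G.Adj (w j) (w i) := fun i j hij =>
    hwadj j _ (hPmono _ _ (by rw [Fin.lt_def] at hij; omega) (by omega) (hwP i))
  have hwne : ∀ i j, i ≠ j → G.Adj (w i) (w j) := fun i j hij =>
    (lt_or_gt_of_ne hij).elim (fun h => (hwlt i j h).symm) fun h => hwlt j i h
  -- the vertices of small degree
  let H : SimpleGraph {v // v ∉ Hi} := F.comap Subtype.val
  obtain ⟨τ, hτD, hproper, hτ⟩ := exists_layering H D (fun v => by
    have h1 : #{u | F.Adj v u} ≤ D :=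
      not_lt.mp fun h => v.2 (mem_filter.mpr ⟨mem_univ _, h⟩)
    refine le_trans ?_ h1
    rw [← card_map (Function.Embedding.subtype _)]
    apply card_le_card
    intro u
    simp only [mem_map, mem_filter, mem_univ, true_and]
    rintro ⟨u', hu', rfl⟩
    exact hu')
  obtain ⟨φ, hφ, hφP, hφadj⟩ := exists_greedy_embedding H G hn τ hτD hproper hτ P
    (fun r hr => (hstep r (by omega)).1)
    (fun r hr => by
      have h1 := hcard r hr
      have h2 : 1 ≤ ∏ i ∈ range r, stepCost k D i :=
        prod_induction _ (1 ≤ ·) (fun _ _ => one_le_mul_of_one_le_of_one_le) le_rfl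
          fun i _ => one_le_stepCost (by omega) D i
      have h3 : (2 * n : ℝ) ≤ #(P r) := by nlinarith
      exact_mod_cast h3)
    (fun r hr => by
      have h1 := (hstep r (by omega)).2.1 hr
      rcases Nat.eq_zero_or_pos (#(badTuples G (r + 1) (2 * n) (P (r + 1)) (P r))) with h0 | hpos
      · rw [h0, zero_mul]
        positivity
      set β := #(badTuples G (r + 1) (2 * n) (P (r + 1)) (P r))
      obtain ⟨y, hy⟩ : ∃ y, y = (r + 1) * (r + 2) := ⟨_, rfl⟩
      rw [← hy]
      have h2 : 6 * n * (2 * y) ^ (r + 1) < #(P (r + 1)) := by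
        have h3 := hcard (r + 1) (by omega)
        have h4 := pow_le_prod_stepCost (k := k) (D := D) (t := r + 1) hk (by omega)
        have h7 : 8 * (n : ℝ) * ((2 * ((r + 1) * (r + 1 + 1)) : ℕ) : ℝ) ^ (r + 1) ≤
            #(P (r + 1)) + 2 := le_trans (by gcongr) h3
        have h8 : 8 * n * (2 * y) ^ (r + 1) ≤ #(P (r + 1)) + 2 := by
          rw [hy]
          exact_mod_cast h7
        have h9 : 4 ≤ 2 * n * (2 * y) ^ (r + 1) := by
          have h10 : 2 ≤ (2 * y) ^ (r + 1) := by
            calc 2 ≤ 2 * y := by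
                  have : 0 < y := by rw [hy]; positivity
                  omega
              _ ≤ _ := Nat.le_self_pow (by omega) _
          nlinarith
        nlinarith
      have h3 : (6 * n * 2 ^ (r + 1)) * (β * y ^ (r + 1)) <
          (6 * n * 2 ^ (r + 1)) * n ^ (r + 1) := by
        calc (6 * n * 2 ^ (r + 1)) * (β * y ^ (r + 1)) = β * (6 * n * (2 * y) ^ (r + 1)) := by
              rw [mul_pow]
              ring
          _ < β * #(P (r + 1)) := by gcongr
          _ ≤ 3 * (2 * n) ^ (r + 2) := h1
          _ = _ := by ring
      exact Nat.lt_of_mul_lt_mul_left h3)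
    ((Fintype.card_subtype_le _).trans hV)
  set ψ : V → α := fun v => if h : v ∈ Hi then w (Hi.equivFin ⟨v, h⟩) else φ ⟨v, h⟩ with hψ
  have hHL : ∀ u v, u ∈ Hi → v ∉ Hi → G.Adj (ψ u) (ψ v) := by
    intro u v hu hv
    simp only [hψ, dif_pos hu, dif_neg hv]
    exact hwadj _ _ (hPmono _ _ (by have := hτD ⟨v, hv⟩; omega) (by omega) (hφP ⟨v, hv⟩))
  have hHH : ∀ u v, u ∈ Hi → v ∈ Hi → u ≠ v → G.Adj (ψ u) (ψ v) := by
    intro u v hu hv huv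
    simp only [hψ, dif_pos hu, dif_pos hv]
    exact hwne _ _ fun h => huv (congrArg Subtype.val (Hi.equivFin.injective h))
  have hHne : ∀ u v, u ≠ v → (u ∈ Hi ∨ v ∈ Hi) → G.Adj (ψ u) (ψ v) := by
    intro u v huv h
    by_cases hu : u ∈ Hi <;> by_cases hv : v ∈ Hi
    · exact hHH u v hu hv huv
    · exact hHL u v hu hv
    · exact (hHL v u hv hu).symm
    · exact absurd h (by tauto)
  refine ⟨⟨⟨ψ, fun {u v} huv => ?_⟩, fun u v huv => ?_⟩⟩
  · by_cases h : u ∈ Hi ∨ v ∈ Hi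
    · exact hHne u v huv.ne h
    · rw [not_or] at h
      simp only [hψ, dif_neg h.1, dif_neg h.2]
      exact hφadj _ _ huv
  · by_contra hne
    by_cases h : u ∈ Hi ∨ v ∈ Hi
    · exact (hHne u v hne h).ne huv
    · rw [not_or] at h
      change ψ u = ψ v at huv
      simp only [hψ, dif_neg h.1, dif_neg h.2] at huv
      exact hne (congrArg Subtype.val (hφ huv))

/-- The number of colored vertices that suffices, in terms of the number `h` of vertices of `F` of
degree above `D + 1`. Since only one color has to make its last step, its cost is counted once. -/
lemma exists_isContained_of_le_card {V α : Type*} [Fintype V] [Fintype α] (F : SimpleGraph V)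
    {k n D h : ℕ} (hk : 3 ≤ k) (hn : 0 < n) (hV : Fintype.card V ≤ n)
    (hh : #{v | D + 1 < #{u | F.Adj v u}} = h) (G : Fin k → SimpleGraph α)
    (hG : ∀ u v, u ≠ v → ∃ c, (G c).Adj u v)
    (hα : 8 * (n : ℝ) * (3 / 2 * k ^ 2) *
      ((k : ℝ) ^ h * ∏ i ∈ range D, (3 / 2 * (k : ℝ) ^ (i + 3))) ^ k ≤ Fintype.card α + 2) :
    ∃ c, F.IsContained (G c) := by
  have hn' : (1 : ℝ) ≤ n := by exact_mod_cast hn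
  obtain ⟨c, P, -, hPstep, hPc⟩ := exists_chain (l := D + h)
    (fun c => ColorStep (G c) (D + 1) (2 * n))
    (fun _ _ _ _ hs => hs.1) (fun _ _ _ _ _ hs => hs.mono) (stepCost k (D + 1))
    (one_le_stepCost (by omega) _) (M := 8 * n) (by positivity)
    (fun A => by
      obtain ⟨c, hc⟩ := exists_colorStep (by omega : 2 ≤ k) G hG (D + 1)
        (by omega : 0 < 2 * n) A
      refine ⟨c, fun r _ hr => hc r (le_trans ?_ hr)⟩
      have := one_le_stepCost (by omega : 1 ≤ k) (D + 1) r
      nlinarith)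
    (fun _ => D + h) univ (fun _ => le_rfl) (by
      refine le_trans (le_of_eq ?_) hα
      have h1 : ∏ i ∈ range (D + h), stepCost k (D + 1) (i + 1) =
          k ^ h * ∏ i ∈ range D, (3 / 2 * (k : ℝ) ^ (i + 3)) := by
        rw [prod_range_add, mul_comm]
        congr 1
        · rw [← card_range h, ← prod_const, card_range]
          refine prod_congr rfl fun i _ => ?_
          rw [stepCost, if_neg (by omega)]
        · refine prod_congr rfl fun i hi => ?_
          rw [mem_range] at hi
          rw [stepCost, if_pos (by omega)]
      rw [h1, prod_const, card_univ, Fintype.card_fin]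
      simp [stepCost])
  refine ⟨c, isContained_of_chain F (G c) (D := D + 1) hk hn hV P (fun r hr => ?_) fun r hr => ?_⟩
  · rw [hh] at hr
    exact hPstep r (by omega)
  · exact hPc r (by omega)

/-! ### The numerical bound -/

lemma prod_mul_pow_le_rpow {k : ℕ} (hk : 3 ≤ k) (D : ℕ) :
    ∏ i ∈ range D, (3 / 2 * (k : ℝ) ^ (i + 3)) ≤ (k : ℝ) ^ ((D : ℝ) ^ 2 / 2 + 3 * D) := by
  have hk' : (3 : ℝ) ≤ k := by exact_mod_cast hk
  have hk0 : (0 : ℝ) < k := by linarith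
  have h1 : (3 / 2 : ℝ) ≤ (k : ℝ) ^ (1 / 2 : ℝ) := by
    rw [← Real.sqrt_eq_rpow]
    apply Real.le_sqrt_of_sq_le
    linarith
  induction D with
  | zero => simp
  | succ D ih =>
    have h2 : ((D + 1 : ℕ) : ℝ) ^ 2 / 2 + 3 * (D + 1 : ℕ) =
        ((D : ℝ) ^ 2 / 2 + 3 * D) + (1 / 2 + (D + 3 : ℕ)) := by
      push_cast
      ring
    rw [prod_range_succ, h2, Real.rpow_add hk0 (_ / 2 + _), Real.rpow_add hk0 (1 / 2),
      Real.rpow_natCast]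
    gcongr

/-- The exponents of `k` match: `d` is the cube root of twice the number of edges, and `D + 1` is
its integer part. -/
lemma exponent_le {d h D : ℝ} (hD : 0 ≤ D) (hd : D + 1 ≤ d) (hd' : d ≤ D + 2)
    (hh : h * (D + 2) ≤ d ^ 3) : 1 + (h + (D ^ 2 / 2 + 3 * D)) ≤ 3 / 2 * d ^ 2 + d := by
  obtain ⟨x, rfl⟩ : ∃ x, d = D + 1 + x := ⟨d - (D + 1), by ring⟩
  have hx0 : 0 ≤ x := by linarith
  have hx1 : x ≤ 1 := by linarith
  have h1 : (1 + (h + (D ^ 2 / 2 + 3 * D))) * (D + 2) ≤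
      (3 / 2 * (D + 1 + x) ^ 2 + (D + 1 + x)) * (D + 2) := by
    have h2 : 0 ≤ x * (1 - x) := mul_nonneg hx0 (by linarith)
    have h3 : 0 ≤ x * (1 - x) * x := mul_nonneg h2 hx0
    have h4 : 0 ≤ x * (1 - x) * D := mul_nonneg h2 hD
    have h5 : 0 ≤ x * D := mul_nonneg hx0 hD
    nlinarith
  exact le_of_mul_le_mul_right h1 (by linarith)

/-- The factor `3 * k ^ 2` that comes from the single last step is absorbed by the term `1` on the
left-hand side of `exponent_le`, as `3 * k ^ 2 ≤ k ^ k`. -/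
lemma size_bound {k n h D : ℕ} {d : ℝ} (hk : 3 ≤ k) (hd : (D : ℝ) + 1 ≤ d)
    (hd' : d ≤ D + 2) (hh : (h : ℝ) * (D + 2) ≤ d ^ 3) :
    8 * (n : ℝ) * (3 / 2 * k ^ 2) *
      ((k : ℝ) ^ h * ∏ i ∈ range D, (3 / 2 * (k : ℝ) ^ (i + 3))) ^ k ≤
      (k : ℝ) ^ (k * (3 / 2 * d ^ 2 + d)) * (4 * n) := by
  have hk' : (3 : ℝ) ≤ k := by exact_mod_cast hk
  have hk0 : (0 : ℝ) < k := by linarith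
  have h1 : (3 : ℝ) * k ^ 2 ≤ (k : ℝ) ^ (k : ℝ) := by
    calc (3 : ℝ) * k ^ 2 ≤ k * k ^ 2 := by gcongr
      _ = (k : ℝ) ^ 3 := by ring
      _ ≤ (k : ℝ) ^ k := pow_le_pow_right₀ (by linarith) hk
      _ = _ := (Real.rpow_natCast _ _).symm
  have h2 : ((k : ℝ) ^ h * ∏ i ∈ range D, (3 / 2 * (k : ℝ) ^ (i + 3))) ^ k ≤
      (k : ℝ) ^ (((h : ℝ) + ((D : ℝ) ^ 2 / 2 + 3 * D)) * k) := by
    rw [Real.rpow_mul hk0.le, Real.rpow_natCast, Real.rpow_add hk0, Real.rpow_natCast]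
    gcongr
    exact prod_mul_pow_le_rpow hk D
  calc _ = (3 * (k : ℝ) ^ 2) *
        ((k : ℝ) ^ h * ∏ i ∈ range D, (3 / 2 * (k : ℝ) ^ (i + 3))) ^ k * (4 * n) := by ring
    _ ≤ (k : ℝ) ^ (k : ℝ) * (k : ℝ) ^ (((h : ℝ) + ((D : ℝ) ^ 2 / 2 + 3 * D)) * k) *
        (4 * n) := by gcongr
    _ ≤ _ := by
        rw [← Real.rpow_add hk0]
        gcongr
        · linarith
        · have := exponent_le (Nat.cast_nonneg D) hd hd' hh
          nlinarith

theorem theorem1 {V : Type*} [Finite V] (F : SimpleGraph V) (hF : ∀ v : V, ¬ F.IsIsolated v)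
    (m : ℕ) (hm : F.edgeSet.ncard = m) (k : ℕ) (hk : 3 ≤ k) :
    (∃ n : ℕ, RamseyArrows k F n) ∧
    (multicolorRamsey k F : ℝ) ≤
      (k : ℝ) ^ (3 * (2 : ℝ) ^ (-(1 / 3) : ℝ) * (k : ℝ) * (m : ℝ) ^ (2 / 3 : ℝ)
          + (k : ℝ) * (2 * (m : ℝ)) ^ (1 / 3 : ℝ)) * (8 * (m : ℝ)) := by
  have := Fintype.ofFinite V
  have hsum : ∑ v, #{u | F.Adj v u} = 2 * m := by
    rw [← hm, Set.ncard_eq_toFinset_card', ← SimpleGraph.edgeFinset,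
      ← F.sum_degrees_eq_twice_card_edges]
    refine sum_congr rfl fun v _ => ?_
    rw [← F.card_neighborFinset_eq_degree, F.neighborFinset_eq_filter]
  have hdeg : ∀ v, 1 ≤ #{u | F.Adj v u} := by
    intro v
    obtain ⟨u, hu⟩ : ∃ u, F.Adj v u := by
      by_contra! h
      exact hF v h
    exact card_pos.mpr ⟨u, by simpa using hu⟩
  have hV : Fintype.card V ≤ 2 * m := by
    rw [← hsum, ← card_univ, card_eq_sum_ones]
    exact sum_le_sum fun v _ => hdeg v
  set R : ℝ := (k : ℝ) ^ (3 * (2 : ℝ) ^ (-(1 / 3) : ℝ) * (k : ℝ) * (m : ℝ) ^ (2 / 3 : ℝ)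
    + (k : ℝ) * (2 * (m : ℝ)) ^ (1 / 3 : ℝ)) * (8 * (m : ℝ)) with hR
  have hR0 : 0 ≤ R := by positivity
  suffices h : RamseyArrows k F ⌊R⌋₊ by
    refine ⟨⟨_, h⟩, le_trans ?_ (Nat.floor_le hR0)⟩
    exact_mod_cast Nat.sInf_le h
  intro C
  rcases Nat.eq_zero_or_pos m with rfl | hmpos
  · have : IsEmpty V := Fintype.card_eq_zero_iff.mp (by omega)
    exact ⟨⟨0, by omega⟩, ⟨⟨⟨isEmptyElim, fun {a} => isEmptyElim a⟩, fun a => isEmptyElim a⟩⟩⟩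
  have hm1 : (1 : ℝ) ≤ m := by exact_mod_cast hmpos
  set d : ℝ := (2 * (m : ℝ)) ^ (1 / 3 : ℝ) with hd
  have hd3 : d ^ 3 = 2 * m := by
    rw [hd, ← Real.rpow_natCast, ← Real.rpow_mul (by positivity)]
    norm_num
  have hd2 : 2 * ((2 : ℝ) ^ (-(1 / 3) : ℝ) * (m : ℝ) ^ (2 / 3 : ℝ)) = d ^ 2 := by
    have h1 : (2 : ℝ) * (2 : ℝ) ^ (-(1 / 3) : ℝ) = (2 : ℝ) ^ (2 / 3 : ℝ) := by
      rw [← Real.rpow_one_add' (by norm_num) (by norm_num)]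
      norm_num
    rw [← mul_assoc, h1, hd, ← Real.rpow_natCast, ← Real.rpow_mul (by positivity),
      ← Real.mul_rpow (by norm_num) (by positivity)]
    norm_num
  have hd1 : 1 ≤ d := Real.one_le_rpow (by linarith) (by norm_num)
  obtain ⟨D, hD⟩ : ∃ D, ⌊d⌋₊ = D + 1 :=
    ⟨⌊d⌋₊ - 1, by have := Nat.le_floor (n := 1) (by simpa using hd1); omega⟩
  have hDd : (D : ℝ) + 1 ≤ d := by
    have := Nat.floor_le (by linarith : 0 ≤ d)
    rw [hD] at this
    exact_mod_cast this
  have hdD : d ≤ D + 2 := by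
    have := (Nat.lt_floor_add_one d).le
    rw [hD] at this
    push_cast at this
    linarith
  have hh : #{v | D + 1 < #{u | F.Adj v u}} * (D + 2) ≤ 2 * m := by
    rw [← hsum, ← smul_eq_mul, ← sum_const]
    refine le_trans (sum_le_sum fun v hv => ?_)
      (sum_le_sum_of_subset (f := fun v => #{u | F.Adj v u}) (subset_univ _))
    exact (mem_filter.mp hv).2
  refine exists_isContained_of_le_card F (n := 2 * m) (D := D) hk (by omega) hV rfl
    C.labelGraph ?_ ?_
  · intro u v huv
    exact ⟨C.get u v huv, (SimpleGraph.TopEdgeLabeling.labelGraph_adj u v).mpr ⟨huv, rfl⟩⟩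
  · have h1 := size_bound (n := 2 * m) hk hDd hdD (by rw [hd3]; exact_mod_cast hh)
    have h2 : (k : ℝ) ^ (k * (3 / 2 * d ^ 2 + d)) * (4 * (2 * m : ℕ)) = R := by
      rw [hR, ← hd2]
      push_cast
      ring_nf
    rw [h2] at h1
    refine h1.trans ?_
    rw [Fintype.card_fin]
    have := Nat.lt_floor_add_one R
    linarith
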